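/- All graphs are finite and simple. For a graph $F$, let $\mathrm{Forb}(F)$ be the class of all graphs that do not contain $F$ as an induced subgraph; assume that it contains graphs of unbounded order. For graphs $G,H$ on a common vertex set $V$ put $\mathrm{dist}(G,H)=|E(G)\,\triangle\,E(H)|/\binom{|V|}{2}$, and let $\mathrm{dist}(G,\mathcal H)$ be the minimum of $\mathrm{dist}(G,H)$ over $H\in\mathcal H$ with $V(H)=V(G)$. The edit distance function of $\mathcal H=\mathrm{Forb}(F)$ is $$\mathrm{ed}_{\mathcal H}(p)=\limsup_{n\to\infty}\max\Bigl\{\mathrm{dist}(G,\mathcal H): |V(G)|=n,\ |E(G)|=\bigl\lfloor p\tbinom n2\bigr\rfloor\Bigr\},\qquad p\in[0,1].$$ A colored regularity graph (CRG) $K$ is a finite nonempty clique with each vertex colored black or white and each edge colored black, white or gray. Write $F\mapsto K$ if there is $\phi\colon V(F)\to V(K)$ such that for every edge $uv$ of $F$ either $\phi(u)=\phi(v)$ is a black vertex or $\phi(u)\phi(v)$ is a black or gray edge, and for every pair $u\ne v$ with $uv\notin E(F)$ either $\phi(u)=\phi(v)$ is a white vertex or $\phi(u)\phi(v)$ is a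 white or gray edge. Let $\mathcal K(\mathcal H)$ be the set of CRGs $K$ with $F\not\mapsto K$. Let $M_K(p)$ be the symmetric matrix indexed by $V(K)$ with diagonal entry $p$ at white vertices and $1-p$ at black vertices, and off-diagonal entry $p$, $1-p$, $0$ at white, black, gray edges respectively, and let $g_K(p)$ be the minimum of $\langle\mu,M_K(p)\mu\rangle$ over all probability vectors $\mu$ on $V(K)$. A point $p_0\in[0,1]$ is a regular point of $\mathcal H$ if there are $\varepsilon>0$ and a finite set $\mathcal K'\subseteq\mathcal K(\mathcal H)$ such that $\mathrm{ed}_{\mathcal H}(p)=\min_{K\in\mathcal K'}g_K(p)$ for every $p\in(p_0-\varepsilon,p_0+\varepsilon)\cap[0,1]$; otherwise $p_0$ is an accumulation point of $\mathcal H$. **Theorem.** The point $p=0$ is an accumulation point of $\mathrm{Forb}(K_{3,3})$, and it is an accumulation point of $\mathrm{Forb}(K_{2,t})$ for every integer $t\ge 9$. -/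

import Mathlib

noncomputable section

namespace EditDistance

/-- A finite simple graph, bundled with its vertex set. -/
structure FinGraph : Type 1 where
  V : Type
  [fintype : Fintype V]
  graph : SimpleGraph V

attribute [instance] FinGraph.fintype

/-- The complete bipartite graph with parts of sizes `s` and `t`. -/
def completeBipartite (s t : ℕ) : FinGraph where
  V := Fin s ⊕ Fin t
  graph := completeBipartiteGraph (Fin s) (Fin t)

/-- The graphs that contain no member of `𝓕` as an induced subgraph. -/
def Forb (𝓕 : Set FinGraph) : Set FinGraph :=
  {G | ∀ F ∈ 𝓕, ¬ F.graph.IsIndContained G.graph}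

/-- A property is non-trivial if it contains graphs of unbounded order. -/
def IsNontrivial (𝓗 : Set FinGraph) : Prop :=
  ∀ n : ℕ, ∃ G ∈ 𝓗, n ≤ Fintype.card G.V

/-- Normalized edit distance between two graphs on the same vertex set. -/
def dist {V : Type} [Fintype V] (G H : SimpleGraph V) : ℝ :=
  ((symmDiff G.edgeSet H.edgeSet).ncard : ℝ) / ((Fintype.card V).choose 2 : ℝ)

/-- Distance from a graph to a property; the infimum is over a finite set, which is nonempty
when the property is hereditary and non-trivial. -/
def distTo {V : Type} [Fintype V] (G : SimpleGraph V) (𝓗 : Set FinGraph) : ℝ :=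
  sInf {d : ℝ | ∃ H : SimpleGraph V, FinGraph.mk V H ∈ 𝓗 ∧ d = dist G H}

/-- The largest distance to `𝓗` of an `n`-vertex graph with `⌊p * (n choose 2)⌋` edges; for
`p ∈ [0, 1]` the supremum is over a finite nonempty set. -/
def maxDist (𝓗 : Set FinGraph) (p : ℝ) (n : ℕ) : ℝ :=
  sSup {d : ℝ | ∃ G : SimpleGraph (Fin n),
    G.edgeSet.ncard = ⌊p * (n.choose 2 : ℝ)⌋₊ ∧ d = distTo G 𝓗}

/-- The edit distance function. -/
def ed (𝓗 : Set FinGraph) (p : ℝ) : ℝ :=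
  Filter.limsup (maxDist 𝓗 p) Filter.atTop

inductive VertexColor
  | black
  | white

inductive EdgeColor
  | black
  | white
  | gray

/-- A colored regularity graph: a finite (nonempty) clique whose vertices are colored black or
white and whose edges are colored black, white or gray. Only the values of `edge` on pairs of
distinct vertices are ever used. -/
structure CRG : Type 1 where
  V : Type
  [fintype : Fintype V]
  [nonempty : Nonempty V]
  vertex : V → VertexColor
  edge : V → V → EdgeColor
  edge_symm : ∀ x y, edge x y = edge y x

attribute [instance] CRG.fintype CRG.nonempty

/-- The relation `F ↦ K`. -/
def MapsTo (F : FinGraph) (K : CRG) : Prop :=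
  ∃ φ : F.V → K.V,
    (∀ u v, F.graph.Adj u v →
      (φ u = φ v ∧ K.vertex (φ u) = .black) ∨
      (φ u ≠ φ v ∧ (K.edge (φ u) (φ v) = .black ∨ K.edge (φ u) (φ v) = .gray))) ∧
    (∀ u v, u ≠ v → ¬ F.graph.Adj u v →
      (φ u = φ v ∧ K.vertex (φ u) = .white) ∨
      (φ u ≠ φ v ∧ (K.edge (φ u) (φ v) = .white ∨ K.edge (φ u) (φ v) = .gray)))

/-- The CRGs `K` of the hereditary property `Forb 𝓕`: those with `F ↦ K` for no `F ∈ 𝓕`. -/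
def crgs (𝓕 : Set FinGraph) : Set CRG :=
  {K | ∀ F ∈ 𝓕, ¬ MapsTo F K}

def VertexColor.weight (p : ℝ) : VertexColor → ℝ
  | .black => 1 - p
  | .white => p

def EdgeColor.weight (p : ℝ) : EdgeColor → ℝ
  | .black => 1 - p
  | .white => p
  | .gray => 0

open Classical in
/-- The matrix `M_K(p)`. -/
def CRG.matrix (K : CRG) (p : ℝ) : Matrix K.V K.V ℝ :=
  Matrix.of fun x y => if x = y then (K.vertex x).weight p else (K.edge x y).weight p

/-- The function `g_K(p)`, the minimum of the quadratic form of `M_K(p)` over the simplex of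
probability masses on the vertices (a nonempty compact set). -/
def CRG.g (K : CRG) (p : ℝ) : ℝ :=
  sInf ((fun μ : K.V → ℝ => μ ⬝ᵥ (K.matrix p).mulVec μ) '' stdSimplex ℝ K.V)

/-- `p₀` is a regular point of `Forb 𝓕`: on a relatively open interval of `[0, 1]` around `p₀`,
the edit distance function is the minimum of the `g_K` over a finite set of CRGs. -/
def IsRegularPoint (𝓕 : Set FinGraph) (p₀ : ℝ) : Prop :=
  ∃ ε : ℝ, 0 < ε ∧ ∃ 𝓚 : Set CRG, 𝓚.Finite ∧ 𝓚 ⊆ crgs 𝓕 ∧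
    ∀ p ∈ Set.Ioo (p₀ - ε) (p₀ + ε) ∩ Set.Icc 0 1,
      IsLeast ((fun K : CRG => K.g p) '' 𝓚) (ed (Forb 𝓕) p)

/-- `p₀ ∈ [0, 1]` is an accumulation point of the non-trivial hereditary property `Forb 𝓕`. -/
def IsAccumulationPoint (𝓕 : Set FinGraph) (p₀ : ℝ) : Prop :=
  IsNontrivial (Forb 𝓕) ∧ p₀ ∈ Set.Icc (0 : ℝ) 1 ∧ ¬ IsRegularPoint 𝓕 p₀

end EditDistance

end

/-!
The proof needs only the elementary half of the description of the edit distance function as an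
infimum over CRGs: `ed (Forb 𝓕) p` is at most the value of the quadratic form of `M_K(p)` at any
probability vector, for every `K` in `crgs 𝓕` (`ed_le_form`). Indeed, if the vertices of a graph are
sent to `K` at random and the graph is edited to respect the colors of `K`, the result lies in
`Forb 𝓕`, and the expected number of edits is the form at the density of the graph times the number
of pairs. Hence zero is an accumulation point as soon as the CRGs of bounded size are beaten by
larger ones at arbitrarily small densities (`not_isRegularPoint_zero`).

In a CRG of `Forb (K_{s,t})` all edges between white vertices are white. If `K` has at most `N`
vertices, this alone gives `g_K(p) ≥ p - N p²` (`CRG.sub_card_mul_sq_le_g`). For `K_{2,t}`, moreover,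
the black vertices joined to a given white vertex by gray or black edges are joined to each other by
black edges, so they act as one vertex, and `g_K(p) ≥ p (1 - p)` once `p (N + 1) ≤ 1`
(`CRG.mul_one_sub_le_g`).

The large CRGs have `n` black vertices, with gray edges given by a `d`-regular relation and all other
edges white. With uniform weights they yield `p + (1 - p d) / n` (`blackCRG_form_uniform_le`); at
`p = 2 / d` this is `p - 1 / n = p - (d² / (4 n)) p²`, so only the ratio `d² / n` matters.

* For `K_{3,3}` the ratio has to be unbounded, and the gray edges have to be free of triangles and of
  `K_{3,3}`. The bipartite double of the projective norm graph over the field with `q²` elements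
  (`normRel`) has `d = q² - 1` and `n = 2 q² (q - 1)`.
* For `K_{2,t}` the ratio has to exceed `4`. The relation `b + b' ≡ a a'` on pairs with `a` in a field
  of `q = 5 ^ k` elements and `b` in its quotient by the prime field (`quotientRel`) has `d = q`,
  `n = q² / 5`, and codegrees at most `5`. Since two vertices in the part of size `t` can be absorbed
  by the images of the other part, `t - 2 > 5` suffices.
-/

namespace EditDistance

open Filter Topology Finset

/-! ### Every CRG bounds the edit distance function from above -/

/-- The color of a vertex, read as the color of the pair formed by the vertex and itself. -/
def VertexColor.toEdgeColor : VertexColor → EdgeColor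
  | .black => .black
  | .white => .white

namespace CRG

variable (K : CRG)

open Classical in
/-- The color of a pair of vertices of a CRG; on the diagonal it is the color of the vertex. -/
noncomputable def color (x y : K.V) : EdgeColor :=
  if x = y then (K.vertex x).toEdgeColor else K.edge x y

lemma color_symm (x y : K.V) : K.color x y = K.color y x := by
  by_cases h : x = y
  · rw [h]
  · rw [color, color, if_neg h, if_neg (Ne.symm h), K.edge_symm]

lemma matrix_apply (p : ℝ) (x y : K.V) : K.matrix p x y = (K.color x y).weight p := by
  by_cases h : x = y
  · subst h
    cases hx : K.vertex x <;>
      simp [matrix, color, hx, VertexColor.toEdgeColor, VertexColor.weight, EdgeColor.weight]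
  · simp [matrix, color, h]

/-- The quadratic form of the matrix `M_K(p)`. -/
noncomputable def form (p : ℝ) (μ : K.V → ℝ) : ℝ :=
  ∑ x, ∑ y, μ x * μ y * (K.color x y).weight p

lemma form_eq (p : ℝ) (μ : K.V → ℝ) : μ ⬝ᵥ (K.matrix p).mulVec μ = K.form p μ := by
  simp only [dotProduct, Matrix.mulVec, form, mul_sum, matrix_apply]
  exact sum_congr rfl fun x _ => sum_congr rfl fun y _ => by ring

end CRG

lemma EdgeColor.weight_nonneg {p : ℝ} (h0 : 0 ≤ p) (h1 : p ≤ 1) (c : EdgeColor) :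
    0 ≤ c.weight p := by
  cases c <;> simp only [EdgeColor.weight] <;> linarith

lemma EdgeColor.continuous_weight (c : EdgeColor) : Continuous fun p => c.weight p := by
  cases c <;> simp only [EdgeColor.weight] <;> fun_prop

/-- Weights are affine in the density, so averaging them over the pairs of a graph evaluates
them at the density of the graph. -/
lemma EdgeColor.sum_weight {ι : Type*} (s : Finset ι) (q : ι → ℝ) (hs : (#s : ℝ) ≠ 0)
    (c : EdgeColor) : ∑ i ∈ s, c.weight (q i) = #s * c.weight ((∑ i ∈ s, q i) / #s) := by
  cases c <;> simp only [EdgeColor.weight, sum_sub_distrib, sum_const, nsmul_eq_mul] <;>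
    field_simp

namespace CRG

variable (K : CRG)

lemma form_nonneg {p : ℝ} (h0 : 0 ≤ p) (h1 : p ≤ 1) {μ : K.V → ℝ} (hμ : ∀ x, 0 ≤ μ x) :
    0 ≤ K.form p μ :=
  sum_nonneg fun x _ => sum_nonneg fun y _ =>
    mul_nonneg (mul_nonneg (hμ x) (hμ y)) (EdgeColor.weight_nonneg h0 h1 _)

lemma continuous_form (μ : K.V → ℝ) : Continuous fun p => K.form p μ :=
  continuous_finsetSum _ fun _ _ => continuous_finsetSum _ fun _ _ =>
    continuous_const.mul (EdgeColor.continuous_weight _)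

lemma sum_form {ι : Type*} (s : Finset ι) (q : ι → ℝ) (hs : (#s : ℝ) ≠ 0) (μ : K.V → ℝ) :
    ∑ i ∈ s, K.form (q i) μ = #s * K.form ((∑ i ∈ s, q i) / #s) μ := by
  simp only [form]
  rw [sum_comm, mul_sum]
  refine sum_congr rfl fun x _ => ?_
  rw [sum_comm, mul_sum]
  refine sum_congr rfl fun y _ => ?_
  rw [← mul_sum, EdgeColor.sum_weight s q hs]
  ring

/-- The graph obtained from `G` by the fewest edits that make it respect the colors of `K`
along `φ`: pairs over a gray pair are kept, the others are joined or separated. -/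
def recolor {V : Type} (φ : V → K.V) (G : SimpleGraph V) : SimpleGraph V where
  Adj u v := u ≠ v ∧ (K.color (φ u) (φ v) = .black ∨
    K.color (φ u) (φ v) = .gray ∧ G.Adj u v)
  symm := ⟨fun u v h => by
    rw [K.color_symm (φ v), G.adj_comm v u]
    exact ⟨h.1.symm, h.2⟩⟩
  loopless := ⟨fun _ h => h.1 rfl⟩

lemma recolor_mem_Forb {𝓕 : Set FinGraph} (hK : K ∈ crgs 𝓕) {V : Type} [Fintype V]
    (φ : V → K.V) (G : SimpleGraph V) : FinGraph.mk V (K.recolor φ G) ∈ Forb 𝓕 := by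
  rintro F hF ⟨e⟩
  refine hK F hF ⟨fun v => φ (e v), fun u v h => ?_, fun u v huv h => ?_⟩
  · have h' : (K.recolor φ G).Adj (e u) (e v) := e.map_rel_iff.2 h
    obtain ⟨-, h'⟩ := h'
    by_cases hφ : φ (e u) = φ (e v)
    · left
      refine ⟨hφ, ?_⟩
      rw [color, if_pos hφ] at h'
      cases hx : K.vertex (φ (e u)) <;> simp_all [VertexColor.toEdgeColor]
    · right
      refine ⟨hφ, ?_⟩
      rw [color, if_neg hφ] at h'
      exact h'.imp id And.left
  · have h' : ¬ (K.recolor φ G).Adj (e u) (e v) := fun h' => h (e.map_rel_iff.1 h')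
    have hne : e u ≠ e v := fun h => huv (e.injective h)
    have hb : K.color (φ (e u)) (φ (e v)) ≠ .black := fun hb => h' ⟨hne, Or.inl hb⟩
    by_cases hφ : φ (e u) = φ (e v)
    · left
      refine ⟨hφ, ?_⟩
      rw [color, if_pos hφ] at hb
      cases hx : K.vertex (φ (e u)) <;> simp_all [VertexColor.toEdgeColor]
    · right
      refine ⟨hφ, ?_⟩
      rw [color, if_neg hφ] at hb
      cases hx : K.edge (φ (e u)) (φ (e v)) <;> simp_all

open Classical in
/-- A pair is edited exactly when its color disagrees with its status in `G`; the number of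
edits on it is the weight of the color at density `1` or `0`. -/
lemma indicator_symmDiff_recolor {V : Type} (φ : V → K.V) (G : SimpleGraph V) {u v : V}
    (huv : u ≠ v) :
    (if s(u, v) ∈ symmDiff G.edgeSet (K.recolor φ G).edgeSet then (1 : ℝ) else 0) =
      (K.color (φ u) (φ v)).weight (if G.Adj u v then 1 else 0) := by
  simp only [Set.mem_symmDiff, SimpleGraph.mem_edgeSet, recolor]
  by_cases h : G.Adj u v <;> cases hc : K.color (φ u) (φ v) <;>
    simp [h, huv, EdgeColor.weight]

open Classical in
/-- If the vertices of `V` are sent to `K` independently with law `μ`, then the images of two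
distinct vertices have joint law `μ ⊗ μ`. -/
lemma sum_prod_mul_pair {V W : Type} [Fintype V] [Fintype W] {μ : W → ℝ} (hμ : ∑ x, μ x = 1)
    {u v : V} (huv : u ≠ v) (f : W → W → ℝ) :
    ∑ φ : V → W, (∏ i, μ (φ i)) * f (φ u) (φ v) = ∑ x, ∑ y, μ x * μ y * f x y := by
  have key : ∀ x y : W, ∑ φ : V → W, (∏ i, μ (φ i)) * (if φ u = x ∧ φ v = y then 1 else 0) =
      μ x * μ y := by
    intro x y
    let h : V → W → ℝ := fun i z =>
      μ z * ((if i = u then if z = x then 1 else 0 else 1) *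
        (if i = v then if z = y then 1 else 0 else 1))
    have h1 : ∀ φ : V → W, (∏ i, μ (φ i)) * (if φ u = x ∧ φ v = y then 1 else 0) =
        ∏ i, h i (φ i) := by
      intro φ
      simp only [h, prod_mul_distrib, prod_ite_eq', mem_univ, if_true]
      by_cases h1 : φ u = x <;> by_cases h2 : φ v = y <;> simp [h1, h2]
    rw [sum_congr rfl fun φ _ => h1 φ, ← Fintype.prod_sum]
    have h2 : ∀ i, ∑ z, h i z = (if i = u then μ x else 1) * (if i = v then μ y else 1) := by
      intro i
      by_cases hu : i = u
      · have hv : i ≠ v := fun hv => huv (hu.symm.trans hv)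
        simp [h, hu, huv]
      · by_cases hv : i = v
        · simp [h, hv, huv.symm]
        · simp [h, hu, hv, hμ]
    rw [prod_congr rfl fun i _ => h2 i, prod_mul_distrib]
    simp
  calc ∑ φ : V → W, (∏ i, μ (φ i)) * f (φ u) (φ v)
      = ∑ φ : V → W, ∑ x, ∑ y,
          (∏ i, μ (φ i)) * (if φ u = x ∧ φ v = y then 1 else 0) * f x y := by
        refine sum_congr rfl fun φ _ => ?_
        rw [sum_eq_single (φ u), sum_eq_single (φ v)]
        · simp
        · intro y _ hy
          simp [Ne.symm hy]
        · simp
        · intro x _ hx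
          simp [Ne.symm hx]
        · simp
    _ = _ := by
        rw [sum_comm]
        refine sum_congr rfl fun x _ => ?_
        rw [sum_comm]
        refine sum_congr rfl fun y _ => ?_
        rw [← sum_mul, key]

lemma sum_prod_eq_one {V W : Type} [Fintype V] [DecidableEq V] [Fintype W] {μ : W → ℝ}
    (hμ : ∑ x, μ x = 1) : ∑ φ : V → W, ∏ i, μ (φ i) = 1 := by
  rw [← Fintype.prod_sum (fun (_ : V) z => μ z)]
  simp [hμ]

end CRG

lemma dist_nonneg {V : Type} [Fintype V] (G H : SimpleGraph V) : 0 ≤ dist G H := by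
  unfold dist
  positivity

lemma distTo_nonneg {V : Type} [Fintype V] (G : SimpleGraph V) (𝓗 : Set FinGraph) :
    0 ≤ distTo G 𝓗 :=
  Real.sInf_nonneg (by rintro d ⟨H, -, rfl⟩; exact dist_nonneg G H)

lemma distTo_le {V : Type} [Fintype V] {G H : SimpleGraph V} {𝓗 : Set FinGraph}
    (hH : FinGraph.mk V H ∈ 𝓗) : distTo G 𝓗 ≤ dist G H :=
  csInf_le ⟨0, by rintro d ⟨H, -, rfl⟩; exact dist_nonneg G H⟩ ⟨H, hH, rfl⟩

lemma maxDist_nonneg (𝓗 : Set FinGraph) (p : ℝ) (n : ℕ) : 0 ≤ maxDist 𝓗 p n :=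
  Real.sSup_nonneg (by rintro d ⟨G, -, rfl⟩; exact distTo_nonneg G 𝓗)

namespace CRG

variable (K : CRG)

open Classical in
/-- A graph with more than one vertex is at distance at most the form at its own density. The
expected number of edits that recolor it along a random map with law `μ` equals this value times
the number of pairs, so some map does at least as well. -/
lemma distTo_Forb_le_form {𝓕 : Set FinGraph} (hK : K ∈ crgs 𝓕) {V : Type} [Fintype V]
    (hV : 2 ≤ Fintype.card V) (G : SimpleGraph V) {μ : K.V → ℝ} (hμ : μ ∈ stdSimplex ℝ K.V) :
    distTo G (Forb 𝓕) ≤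
      K.form ((G.edgeSet.ncard : ℝ) / ((Fintype.card V).choose 2 : ℝ)) μ := by
  set C : ℝ := ((Fintype.card V).choose 2 : ℝ) with hC
  have hCpos : 0 < C := by
    rw [hC]
    exact_mod_cast Nat.choose_pos hV
  let P : Finset (Sym2 V) := univ.filter fun e => ¬ e.IsDiag
  have hP : (#P : ℝ) = C := by
    rw [hC, ← Sym2.card_subtype_not_diag, Fintype.card_subtype]
  have hncard : ∀ S : Set (Sym2 V), (∀ e ∈ S, ¬ e.IsDiag) →
      (S.ncard : ℝ) = ∑ e ∈ P, if e ∈ S then (1 : ℝ) else 0 := by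
    intro S hS
    rw [← sum_filter, sum_const, nsmul_eq_mul, mul_one, Set.ncard_eq_toFinset_card']
    congr 2
    ext e
    simp only [Set.mem_toFinset, P, mem_filter, mem_univ, true_and]
    exact ⟨fun h => ⟨hS e h, h⟩, And.right⟩
  have hG : (G.edgeSet.ncard : ℝ) = ∑ e ∈ P, if e ∈ G.edgeSet then (1 : ℝ) else 0 :=
    (hncard _ fun e he => G.not_isDiag_of_mem_edgeSet he).trans
      (sum_congr rfl fun _ _ => by congr)
  have hexp : ∑ φ : V → K.V, (∏ i, μ (φ i)) *
      ((symmDiff G.edgeSet (K.recolor φ G).edgeSet).ncard : ℝ) =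
      C * K.form ((G.edgeSet.ncard : ℝ) / C) μ := by
    rw [hG, ← hP, ← K.sum_form P _ (by rw [hP]; exact hCpos.ne')]
    have : ∀ φ : V → K.V, ((symmDiff G.edgeSet (K.recolor φ G).edgeSet).ncard : ℝ) =
        ∑ e ∈ P, if e ∈ symmDiff G.edgeSet (K.recolor φ G).edgeSet then (1 : ℝ) else 0 :=
      fun φ => hncard _ fun e he => by
        rcases (Set.mem_symmDiff).1 he with h | h
        · exact G.not_isDiag_of_mem_edgeSet h.1
        · exact (K.recolor φ G).not_isDiag_of_mem_edgeSet h.1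
    simp only [this, mul_sum]
    rw [sum_comm]
    refine sum_congr rfl fun e he => ?_
    induction e using Sym2.ind with
    | _ u v =>
      have huv : u ≠ v := by simpa [P] using he
      simp only [K.indicator_symmDiff_recolor _ G huv]
      rw [sum_prod_mul_pair hμ.2 huv fun x y =>
        (K.color x y).weight (if G.Adj u v then 1 else 0)]
      simp only [form, SimpleGraph.mem_edgeSet]
  have hw : ∀ φ : V → K.V, 0 ≤ ∏ i, μ (φ i) := fun φ => prod_nonneg fun i _ => hμ.1 _
  have hle : ∑ φ : V → K.V, (∏ i, μ (φ i)) * (C * distTo G (Forb 𝓕)) ≤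
      C * K.form ((G.edgeSet.ncard : ℝ) / C) μ := by
    rw [← hexp]
    refine sum_le_sum fun φ _ => mul_le_mul_of_nonneg_left ?_ (hw φ)
    have := distTo_le (G := G) (K.recolor_mem_Forb hK φ G)
    rw [dist, ← hC, le_div_iff₀ hCpos] at this
    linarith
  rw [← sum_mul, sum_prod_eq_one hμ.2, one_mul] at hle
  exact le_of_mul_le_mul_left hle hCpos

end CRG

/-- The elementary half of the theorem that the edit distance function of a hereditary property
is the infimum of the functions `g_K`. -/
theorem ed_le_form {𝓕 : Set FinGraph} {K : CRG} (hK : K ∈ crgs 𝓕) {p : ℝ} (h0 : 0 ≤ p)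
    (h1 : p ≤ 1) {μ : K.V → ℝ} (hμ : μ ∈ stdSimplex ℝ K.V) : ed (Forb 𝓕) p ≤ K.form p μ := by
  -- the density of a graph with `⌊p * (n choose 2)⌋` edges
  let q : ℕ → ℝ := fun n => (⌊p * (n.choose 2 : ℝ)⌋₊ : ℝ) / (n.choose 2 : ℝ)
  have hq0 : ∀ n, 0 ≤ q n := fun n => by positivity
  have hq1 : ∀ n, q n ≤ 1 := fun n => by
    refine div_le_one_of_le₀ ?_ (Nat.cast_nonneg _)
    refine (Nat.floor_le (by positivity)).trans ?_
    exact mul_le_of_le_one_left (Nat.cast_nonneg _) h1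
  have hchoose : Tendsto (fun n : ℕ => ((n.choose 2 : ℕ) : ℝ)) atTop atTop := by
    refine tendsto_natCast_atTop_atTop.comp (tendsto_atTop_mono' atTop ?_
      (tendsto_sub_atTop_nat 1))
    filter_upwards [eventually_ge_atTop 2] with n hn
    rw [Nat.choose_two_right, Nat.le_div_iff_mul_le two_pos, mul_comm]
    exact Nat.mul_le_mul_right _ hn
  have hq : Tendsto q atTop (𝓝 p) :=
    (tendsto_nat_floor_mul_div_atTop h0).comp hchoose
  have hlim : Tendsto (fun n => K.form (q n) μ) atTop (𝓝 (K.form p μ)) :=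
    ((K.continuous_form μ).tendsto p).comp hq
  have hle : ∀ᶠ n in atTop, maxDist (Forb 𝓕) p n ≤ K.form (q n) μ := by
    filter_upwards [eventually_ge_atTop 2] with n hn
    refine Real.sSup_le ?_ (K.form_nonneg (hq0 n) (hq1 n) hμ.1)
    rintro d ⟨G, hG, rfl⟩
    have := K.distTo_Forb_le_form hK (by simpa using hn) G hμ
    rwa [hG, Fintype.card_fin] at this
  calc ed (Forb 𝓕) p ≤ limsup (fun n => K.form (q n) μ) atTop :=
        limsup_le_limsup hle
          (isCoboundedUnder_le_of_le atTop (x := 0) fun n => maxDist_nonneg _ _ n)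
          hlim.isBoundedUnder_le
    _ = K.form p μ := hlim.limsup_eq

/-! ### Lower bounds on the form of a fixed CRG at small densities -/

namespace CRG

variable (K : CRG)

lemma color_self_eq_black {x : K.V} : K.color x x = .black ↔ K.vertex x = .black := by
  cases h : K.vertex x <;> simp [color, h, VertexColor.toEdgeColor]

end CRG

lemma mapsTo_iff {F : FinGraph} {K : CRG} :
    MapsTo F K ↔ ∃ φ : F.V → K.V,
      (∀ u v, F.graph.Adj u v → K.color (φ u) (φ v) ≠ .white) ∧
      (∀ u v, u ≠ v → ¬ F.graph.Adj u v → K.color (φ u) (φ v) ≠ .black) := by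
  have h1 : ∀ x y : K.V, K.color x y ≠ .white ↔ (x = y ∧ K.vertex x = .black) ∨
      (x ≠ y ∧ (K.edge x y = .black ∨ K.edge x y = .gray)) := by
    intro x y
    by_cases h : x = y
    · subst h
      cases hx : K.vertex x <;> simp [CRG.color, hx, VertexColor.toEdgeColor]
    · cases hx : K.edge x y <;> simp [CRG.color, hx, h]
  have h2 : ∀ x y : K.V, K.color x y ≠ .black ↔ (x = y ∧ K.vertex x = .white) ∨
      (x ≠ y ∧ (K.edge x y = .white ∨ K.edge x y = .gray)) := by
    intro x y
    by_cases h : x = y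
    · subst h
      cases hx : K.vertex x <;> simp [CRG.color, hx, VertexColor.toEdgeColor]
    · cases hx : K.edge x y <;> simp [CRG.color, hx, h]
  simp only [MapsTo, h1, h2]

lemma mem_crgs_singleton {F : FinGraph} {K : CRG} : K ∈ crgs {F} ↔ ¬ MapsTo F K := by
  simp [crgs]

namespace CRG

variable {K : CRG}

/-- Two white vertices joined by a black or gray edge would accommodate the two parts of a
complete bipartite graph. -/
lemma color_eq_white_of_vertex_eq_white {s t : ℕ} (hK : K ∈ crgs {completeBipartite s t})
    {x y : K.V} (hx : K.vertex x = .white) (hy : K.vertex y = .white) :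
    K.color x y = .white := by
  by_contra hne
  rw [mem_crgs_singleton, mapsTo_iff] at hK
  refine hK ⟨Sum.elim (fun _ => x) fun _ => y, ?_, ?_⟩
  · rintro (u | u) (v | v) h
    · simp [completeBipartite] at h
    · exact hne
    · simpa [K.color_symm y x] using hne
    · simp [completeBipartite] at h
  · rintro (u | u) (v | v) - h
    · simp [K.color_self_eq_black, hx]
    · simp [completeBipartite] at h
    · simp [completeBipartite] at h
    · simp [K.color_self_eq_black, hy]

/-- Two black vertices that are joined to a white vertex by edges that are not white are joined
to each other by a black edge: otherwise they would accommodate the two vertices of the smaller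
part of `K_{2,t}`, and the white vertex the other part. -/
lemma color_eq_black_of_common_white {t : ℕ} (hK : K ∈ crgs {completeBipartite 2 t})
    {w x y : K.V} (hw : K.vertex w = .white) (hx : K.vertex x = .black)
    (hwx : K.color w x ≠ .white) (hwy : K.color w y ≠ .white) : K.color x y = .black := by
  by_cases hxy : x = y
  · rw [← hxy, K.color_self_eq_black, hx]
  by_contra hne
  rw [mem_crgs_singleton, mapsTo_iff] at hK
  refine hK ⟨Sum.elim ![x, y] fun _ => w, ?_, ?_⟩
  · rintro (u | u) (v | v) h
    · simp [completeBipartite] at h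
    · fin_cases u <;> simpa [K.color_symm _ w]
    · fin_cases v <;> simpa
    · simp [completeBipartite] at h
  · rintro (u | u) (v | v) huv h
    · have hne' : K.color y x ≠ .black := by rwa [K.color_symm]
      fin_cases u <;> fin_cases v
      exacts [absurd rfl huv, hne, hne', absurd rfl huv]
    · simp [completeBipartite] at h
    · simp [completeBipartite] at h
    · simp [K.color_self_eq_black, hw]

open Classical in
/-- The restriction of a weighting to the white vertices. -/
noncomputable def whitePart (μ : K.V → ℝ) (x : K.V) : ℝ :=
  if K.vertex x = .white then μ x else 0

open Classical in
/-- The restriction of a weighting to the black vertices. -/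
noncomputable def blackPart (μ : K.V → ℝ) (x : K.V) : ℝ :=
  if K.vertex x = .white then 0 else μ x

lemma whitePart_add_blackPart (μ : K.V → ℝ) (x : K.V) :
    whitePart μ x + blackPart μ x = μ x := by
  unfold whitePart blackPart
  split_ifs <;> simp

lemma whitePart_nonneg {μ : K.V → ℝ} (hμ : ∀ x, 0 ≤ μ x) (x : K.V) : 0 ≤ whitePart μ x := by
  unfold whitePart
  split_ifs
  exacts [hμ x, le_rfl]

lemma blackPart_nonneg {μ : K.V → ℝ} (hμ : ∀ x, 0 ≤ μ x) (x : K.V) : 0 ≤ blackPart μ x := by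
  unfold blackPart
  split_ifs
  exacts [le_rfl, hμ x]

/-- The edges between white vertices are white, so the white vertices contribute to the form only
through their total mass and the cross terms. -/
lemma form_split {s t : ℕ} (hK : K ∈ crgs {completeBipartite s t}) (p : ℝ) (μ : K.V → ℝ) :
    K.form p μ = p * (∑ x, whitePart μ x) ^ 2 +
      2 * ∑ x, whitePart μ x * ∑ y, blackPart μ y * (K.color x y).weight p +
      K.form p (blackPart μ) := by
  have hW : ∑ x, ∑ y, whitePart μ x * whitePart μ y * (K.color x y).weight p =
      p * (∑ x, whitePart μ x) ^ 2 := by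
    rw [sq, sum_mul_sum, mul_sum]
    refine sum_congr rfl fun x _ => ?_
    rw [mul_sum]
    refine sum_congr rfl fun y _ => ?_
    by_cases hx : K.vertex x = .white
    · by_cases hy : K.vertex y = .white
      · rw [color_eq_white_of_vertex_eq_white hK hx hy, EdgeColor.weight]
        ring
      · simp [whitePart, hy]
    · simp [whitePart, hx]
  have hWB : ∑ x, ∑ y, blackPart μ x * whitePart μ y * (K.color x y).weight p =
      ∑ x, whitePart μ x * ∑ y, blackPart μ y * (K.color x y).weight p := by
    rw [sum_comm]
    refine sum_congr rfl fun x _ => ?_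
    rw [mul_sum]
    refine sum_congr rfl fun y _ => ?_
    rw [K.color_symm y x]
    ring
  calc K.form p μ = ∑ x, ∑ y,
        (whitePart μ x * whitePart μ y * (K.color x y).weight p +
        whitePart μ x * (blackPart μ y * (K.color x y).weight p) +
        blackPart μ x * whitePart μ y * (K.color x y).weight p +
        blackPart μ x * blackPart μ y * (K.color x y).weight p) := by
        refine sum_congr rfl fun x _ => sum_congr rfl fun y _ => ?_
        nth_rewrite 1 [← whitePart_add_blackPart μ x, ← whitePart_add_blackPart μ y]
        ring
    _ = _ := by
        simp only [sum_add_distrib]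
        rw [hW, hWB, form]
        simp only [← mul_sum]
        ring

/-- By the Cauchy–Schwarz inequality for the diagonal terms. -/
lemma le_form_blackPart {p : ℝ} (h0 : 0 ≤ p) (h1 : p ≤ 1) {μ : K.V → ℝ} (hμ : ∀ x, 0 ≤ μ x) :
    (1 - p) * ((∑ x, blackPart μ x) ^ 2 / Fintype.card K.V) ≤ K.form p (blackPart μ) := by
  classical
  have hcs : (∑ x, blackPart μ x) ^ 2 ≤ Fintype.card K.V * ∑ x, blackPart μ x ^ 2 :=
    sq_sum_le_card_mul_sum_sq
  calc (1 - p) * ((∑ x, blackPart μ x) ^ 2 / Fintype.card K.V)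
      ≤ (1 - p) * ∑ x, blackPart μ x ^ 2 := by
        refine mul_le_mul_of_nonneg_left ?_ (by linarith)
        rwa [div_le_iff₀' (by exact_mod_cast Fintype.card_pos)]
    _ ≤ K.form p (blackPart μ) := by
        rw [mul_sum]
        refine sum_le_sum fun x _ => ?_
        calc (1 - p) * blackPart μ x ^ 2
            ≤ blackPart μ x * blackPart μ x * (K.color x x).weight p := by
              by_cases hx : K.vertex x = .white
              · simp [blackPart, hx]
              · have : K.color x x = .black := by
                  rw [K.color_self_eq_black]
                  cases h : K.vertex x
                  exacts [rfl, absurd h hx]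
                rw [this, EdgeColor.weight]
                exact le_of_eq (by ring)
          _ ≤ _ := single_le_sum (f := fun y => blackPart μ x * blackPart μ y *
                (K.color x y).weight p) (fun y _ => mul_nonneg
                (mul_nonneg (blackPart_nonneg hμ x) (blackPart_nonneg hμ y))
                (EdgeColor.weight_nonneg h0 h1 _)) (mem_univ x)

/-- Discarding the cross terms between white and black vertices. -/
lemma le_form {s t : ℕ} (hK : K ∈ crgs {completeBipartite s t}) {p : ℝ} (h0 : 0 ≤ p)
    (h1 : p ≤ 1) {μ : K.V → ℝ} (hμ : ∀ x, 0 ≤ μ x) :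
    p * (∑ x, whitePart μ x) ^ 2 + (1 - p) * ((∑ x, blackPart μ x) ^ 2 / Fintype.card K.V) ≤
      K.form p μ := by
  have h := le_form_blackPart h0 h1 hμ
  have h' : 0 ≤ ∑ x, whitePart μ x * ∑ y, blackPart μ y * (K.color x y).weight p :=
    sum_nonneg fun x _ => mul_nonneg (whitePart_nonneg hμ x) <| sum_nonneg fun y _ =>
      mul_nonneg (blackPart_nonneg hμ y) (EdgeColor.weight_nonneg h0 h1 _)
  rw [form_split hK]
  linarith

lemma sum_whitePart_add_sum_blackPart {μ : K.V → ℝ} (hμ : μ ∈ stdSimplex ℝ K.V) :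
    ∑ x, whitePart μ x + ∑ x, blackPart μ x = 1 := by
  rw [← sum_add_distrib, ← hμ.2]
  exact sum_congr rfl fun x _ => whitePart_add_blackPart μ x

lemma le_g {a p : ℝ} (h : ∀ μ ∈ stdSimplex ℝ K.V, a ≤ K.form p μ) : a ≤ K.g p := by
  classical
  refine le_csInf (Set.Nonempty.image _ ⟨_, single_mem_stdSimplex ℝ (Classical.arbitrary K.V)⟩) ?_
  rintro _ ⟨μ, hμ, rfl⟩
  simpa only [form_eq] using h μ hμ

/-- For every complete bipartite graph, `g_K(p)` falls below `p` only to second order. -/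
theorem sub_card_mul_sq_le_g {s t : ℕ} (hK : K ∈ crgs {completeBipartite s t}) {p : ℝ}
    (h0 : 0 ≤ p) (h1 : p ≤ 1) {N : ℝ} (hN : (Fintype.card K.V : ℝ) ≤ N) :
    p - N * p ^ 2 ≤ K.g p := by
  refine le_g fun μ hμ => le_trans ?_ (le_form hK h0 h1 hμ.1)
  have hsum := sum_whitePart_add_sum_blackPart hμ
  set α := ∑ x, whitePart μ x
  set β := ∑ x, blackPart μ x
  have hM : (1 : ℝ) ≤ Fintype.card K.V := by exact_mod_cast Fintype.card_pos (α := K.V)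
  set M : ℝ := (Fintype.card K.V : ℝ)
  have hα : α = 1 - β := by linarith
  -- the right side is `p - 2pβ + pβ² + (1 - p)β²/M`; compare `2pβ` with `M p² + β²/M`
  have key : 2 * p * β ≤ M * p ^ 2 + β ^ 2 / M := by
    have : 0 ≤ (M * p - β) ^ 2 / M := by positivity
    have h2 : (M * p - β) ^ 2 / M = M * p ^ 2 - 2 * p * β + β ^ 2 / M := by
      field_simp
      ring
    linarith
  have hMβ : β ^ 2 / M ≤ β ^ 2 := div_le_self (sq_nonneg _) hM
  rw [hα]
  nlinarith [mul_le_mul_of_nonneg_right hN (sq_nonneg p), mul_le_mul_of_nonneg_left hMβ h0]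

open Classical in
/-- The mass of the black vertices that are joined to `w` by a white edge. -/
noncomputable def farPart (w : K.V) (μ : K.V → ℝ) (x : K.V) : ℝ :=
  if K.color w x = .white then blackPart μ x else 0

/-- The black vertices that are not far from a white vertex `w` behave like a single vertex. -/
lemma le_form_blackPart_of_white {t : ℕ} (hK : K ∈ crgs {completeBipartite 2 t}) {w : K.V}
    (hw : K.vertex w = .white) {p : ℝ} (h0 : 0 ≤ p) (h1 : p ≤ 1) {μ : K.V → ℝ}
    (hμ : ∀ x, 0 ≤ μ x) :
    (1 - p) * ((∑ x, blackPart μ x - ∑ x, farPart w μ x) ^ 2 +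
      (∑ x, farPart w μ x) ^ 2 / Fintype.card K.V) ≤ K.form p (blackPart μ) := by
  classical
  have hcs : (∑ x, farPart w μ x) ^ 2 / Fintype.card K.V ≤ ∑ x, farPart w μ x ^ 2 := by
    rw [div_le_iff₀' (by exact_mod_cast Fintype.card_pos)]
    exact sq_sum_le_card_mul_sum_sq
  refine (mul_le_mul_of_nonneg_left (add_le_add_right hcs _) (by linarith)).trans ?_
  rw [← sum_sub_distrib, sq, sum_mul_sum, ← sum_add_distrib, mul_sum]
  refine sum_le_sum fun x _ => ?_
  have hdiag : farPart w μ x ^ 2 = ∑ y, if x = y then farPart w μ x * farPart w μ y else 0 := by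
    simp [sq]
  rw [hdiag, ← sum_add_distrib, mul_sum]
  refine sum_le_sum fun y _ => ?_
  have hnn : 0 ≤ blackPart μ x * blackPart μ y * (K.color x y).weight p :=
    mul_nonneg (mul_nonneg (blackPart_nonneg hμ x) (blackPart_nonneg hμ y))
      (EdgeColor.weight_nonneg h0 h1 _)
  by_cases hx : K.vertex x = .white
  · simp [farPart, blackPart, hx]
  by_cases hy : K.vertex y = .white
  · simp [farPart, blackPart, hy]
  have hxb : K.vertex x = .black := by
    cases h : K.vertex x
    exacts [rfl, absurd h hx]
  by_cases hwx : K.color w x = .white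
  · by_cases hxy : x = y
    · subst hxy
      have : K.color x x = .black := K.color_self_eq_black.2 hxb
      rw [this, EdgeColor.weight]
      simp only [farPart, if_pos hwx, if_true]
      exact le_of_eq (by ring)
    · simpa [farPart, hwx, hxy] using hnn
  · by_cases hwy : K.color w y = .white
    · have hxy : x ≠ y := fun h => hwx (h ▸ hwy)
      simpa [farPart, hwy, hxy] using hnn
    · rw [color_eq_black_of_common_white hK hw hxb hwx hwy, EdgeColor.weight]
      simp only [farPart, if_neg hwx, if_neg hwy]
      refine le_of_eq ?_
      simp
      ring

/-- At small densities no CRG for `K_{2,t}` does better than a white and a black vertex joined by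
a gray edge. -/
theorem mul_one_sub_le_g {t : ℕ} (hK : K ∈ crgs {completeBipartite 2 t}) {p : ℝ}
    (h0 : 0 ≤ p) (hp : p * (Fintype.card K.V + 1) ≤ 1) : p * (1 - p) ≤ K.g p := by
  have hM : (1 : ℝ) ≤ Fintype.card K.V := by exact_mod_cast Fintype.card_pos (α := K.V)
  have h1 : p ≤ 1 := by nlinarith
  have hpM : p ≤ (1 - p) / Fintype.card K.V := by
    rw [le_div_iff₀ (by positivity)]
    linarith
  refine le_g fun μ hμ => ?_
  have hsum := sum_whitePart_add_sum_blackPart hμ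
  by_cases hW : ∃ w, K.vertex w = .white
  · -- the cross terms are linear in the white masses: compare with the cheapest white vertex
    obtain ⟨w, hw, hmin⟩ : ∃ w, K.vertex w = .white ∧ ∀ x, K.vertex x = .white →
        ∑ y, farPart w μ y ≤ ∑ y, farPart x μ y := by
      classical
      obtain ⟨w, hw, h⟩ := exists_min_image
        (univ.filter fun x => K.vertex x = .white) (fun x => ∑ y, farPart x μ y)
        (hW.imp fun w hw => by simpa using hw)
      exact ⟨w, by simpa using hw, fun x hx => h x (by simpa using hx)⟩
    have hcross : p * (∑ x, whitePart μ x) * ∑ y, farPart w μ y ≤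
        ∑ x, whitePart μ x * ∑ y, blackPart μ y * (K.color x y).weight p := by
      rw [mul_comm p, mul_assoc, sum_mul]
      refine sum_le_sum fun x _ => ?_
      by_cases hx : K.vertex x = .white
      · refine mul_le_mul_of_nonneg_left ?_ (whitePart_nonneg hμ.1 x)
        refine (mul_le_mul_of_nonneg_left (hmin x hx) h0).trans ?_
        rw [mul_sum]
        refine sum_le_sum fun y _ => ?_
        by_cases hxy : K.color x y = .white
        · rw [hxy, EdgeColor.weight, farPart, if_pos hxy, mul_comm]
        · rw [farPart, if_neg hxy, mul_zero]
          exact mul_nonneg (blackPart_nonneg hμ.1 y) (EdgeColor.weight_nonneg h0 h1 _)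
      · simp [whitePart, hx]
    have hblack := le_form_blackPart_of_white hK hw h0 h1 hμ.1
    rw [form_split hK]
    set α := ∑ x, whitePart μ x
    set β := ∑ x, blackPart μ x
    set r := ∑ y, farPart w μ y
    have hr : p * r ^ 2 ≤ (1 - p) * (r ^ 2 / Fintype.card K.V) := by
      calc p * r ^ 2 ≤ (1 - p) / Fintype.card K.V * r ^ 2 :=
            mul_le_mul_of_nonneg_right hpM (sq_nonneg r)
        _ = _ := by ring
    have hβ : β = 1 - α := by linarith
    rw [hβ] at hblack
    nlinarith [sq_nonneg (α - (1 - p) * (1 - r) + p * r)]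
  · have hzero : ∑ x, whitePart μ x = 0 :=
      sum_eq_zero fun x _ => if_neg fun hx => hW ⟨x, hx⟩
    have h := le_form hK h0 h1 hμ.1
    have hβ : ∑ x, blackPart μ x = 1 := by linarith
    rw [hzero, hβ] at h
    have : p ≤ (1 - p) * (1 ^ 2 / Fintype.card K.V) := by
      rw [one_pow, mul_one_div]
      exact hpM
    nlinarith

end CRG

/-- Zero is not regular if the CRGs of any bounded size are all beaten, at arbitrarily small
densities, by some other CRG: a finite family has bounded size. -/
lemma not_isRegularPoint_zero {𝓕 : Set FinGraph}
    (h : ∀ N : ℕ, ∀ ε : ℝ, 0 < ε → ∃ p : ℝ, 0 ≤ p ∧ p ≤ 1 ∧ p < ε ∧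
      ∃ K ∈ crgs 𝓕, ∃ μ ∈ stdSimplex ℝ K.V,
        ∀ K' ∈ crgs 𝓕, Fintype.card K'.V ≤ N → K.form p μ < K'.g p) :
    ¬ IsRegularPoint 𝓕 0 := by
  rintro ⟨ε, hε, 𝓚, hfin, hsub, heq⟩
  obtain ⟨N, hN⟩ := (hfin.image fun K : CRG => Fintype.card K.V).bddAbove
  obtain ⟨p, h0, h1, hpε, K, hK, μ, hμ, hlt⟩ := h N ε hε
  obtain ⟨K', hK', hed⟩ := (heq p ⟨⟨by linarith, by linarith⟩, h0, h1⟩).1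
  have := hlt K' (hsub hK') (hN ⟨K', hK', rfl⟩)
  have := ed_le_form hK h0 h1 hμ
  simp only at hed
  linarith

/-! ### CRGs with only black vertices and no black edges -/

open Classical in
/-- The CRG with black vertices only, whose edge `xy` is gray if `r x y` and white otherwise.
The relation may hold on the diagonal, where it is ignored. -/
noncomputable def blackCRG {V : Type} [Fintype V] [Nonempty V] (r : V → V → Prop)
    (hr : ∀ x y, r x y → r y x) : CRG where
  V := V
  vertex _ := .black
  edge x y := if r x y then .gray else .white
  edge_symm x y := by simp only [show r x y ↔ r y x from ⟨hr x y, hr y x⟩]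

section blackCRG

variable {V : Type} [Fintype V] [Nonempty V] {r : V → V → Prop} {hr : ∀ x y, r x y → r y x}

open Classical in
lemma blackCRG_color (x y : V) : (blackCRG r hr).color x y =
    if x = y then .black else if r x y then .gray else .white := by
  simp only [CRG.color]
  rfl

lemma blackCRG_color_ne_black {x y : V} : (blackCRG r hr).color x y ≠ .black ↔ x ≠ y := by
  rw [blackCRG_color]
  split_ifs <;> simp [*]

lemma blackCRG_color_ne_white {x y : V} :
    (blackCRG r hr).color x y ≠ .white ↔ x = y ∨ r x y := by
  rw [blackCRG_color]
  split_ifs <;> simp [*]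

/-- For a complete bipartite graph, the images of the vertices of each part are distinct, and
every image in one part equals or is joined by a gray edge to every image in the other part. -/
lemma blackCRG_mem_crgs {s t : ℕ}
    (h : ∀ (a : Fin s → V) (b : Fin t → V), Function.Injective a → Function.Injective b →
      (∀ i j, a i = b j ∨ r (a i) (b j)) → False) :
    blackCRG r hr ∈ crgs {completeBipartite s t} := by
  rw [mem_crgs_singleton, mapsTo_iff]
  rintro ⟨φ, h1, h2⟩
  refine h (fun i => φ (.inl i)) (fun j => φ (.inr j)) (fun i i' hi => ?_) (fun j j' hj => ?_)
    fun i j => ?_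
  · by_contra hne
    exact blackCRG_color_ne_black.1 (h2 (.inl i) (.inl i') (fun h => hne (Sum.inl_injective h))
      (by simp [completeBipartite])) hi
  · by_contra hne
    exact blackCRG_color_ne_black.1 (h2 (.inr j) (.inr j') (fun h => hne (Sum.inr_injective h))
      (by simp [completeBipartite])) hj
  · exact blackCRG_color_ne_white.1 (h1 (.inl i) (.inr j) (by simp [completeBipartite]))

lemma uniform_mem_stdSimplex : (fun _ => (Fintype.card V : ℝ)⁻¹) ∈ stdSimplex ℝ V :=
  ⟨fun _ => by positivity, by simp⟩

open Classical in
lemma blackCRG_form_uniform_le {d : ℕ} (hd : ∀ x, d ≤ #{y | r x y}) {p : ℝ} (h0 : 0 ≤ p) :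
    (blackCRG r hr).form p (fun _ => (Fintype.card V : ℝ)⁻¹) ≤
      p + (1 - p * d) / Fintype.card V := by
  have hn : (Fintype.card V : ℝ) ≠ 0 := by exact_mod_cast Fintype.card_ne_zero
  have hw : ∀ x y : V, ((blackCRG r hr).color x y).weight p ≤
      p - (if r x y then p else 0) + if x = y then 1 else 0 := by
    intro x y
    rw [blackCRG_color]
    split_ifs <;> simp only [EdgeColor.weight] <;> linarith
  have hrow : ∀ x : V, ∑ y : V, ((blackCRG r hr).color x y).weight p ≤
      p * Fintype.card V - p * d + 1 := by
    intro x
    refine (sum_le_sum fun y _ => hw x y).trans ?_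
    rw [sum_add_distrib, sum_sub_distrib, ← sum_filter]
    have : p * d ≤ p * #{y | r x y} := mul_le_mul_of_nonneg_left (by exact_mod_cast hd x) h0
    simp only [sum_const, nsmul_eq_mul, sum_ite_eq, mem_univ, if_true, card_univ]
    linarith
  calc (blackCRG r hr).form p (fun _ => (Fintype.card V : ℝ)⁻¹)
      = (Fintype.card V : ℝ)⁻¹ * (Fintype.card V : ℝ)⁻¹ *
          ∑ x : V, ∑ y : V, ((blackCRG r hr).color x y).weight p := by
        simp only [CRG.form, mul_sum]
        rfl
    _ ≤ (Fintype.card V : ℝ)⁻¹ * (Fintype.card V : ℝ)⁻¹ *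
          ∑ x : V, (p * Fintype.card V - p * d + 1) :=
        mul_le_mul_of_nonneg_left (sum_le_sum fun x _ => hrow x) (by positivity)
    _ = p + (1 - p * d) / Fintype.card V := by
        rw [sum_const, card_univ, nsmul_eq_mul]
        field_simp
        ring

end blackCRG

/-! ### Relations with bounded codegrees -/

section QuotientRelation

variable {E : Type} [Field E] (H : AddSubgroup E)

/-- The relation `b + b' ≡ a * a'` modulo `H` on the pairs `(a, b)` with `b` taken modulo `H`. -/
def quotientRel (x y : E × (E ⧸ H)) : Prop :=
  x.2 + y.2 = ((x.1 * y.1 : E) : E ⧸ H)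

lemma quotientRel_symm (x y : E × (E ⧸ H)) (h : quotientRel H x y) : quotientRel H y x := by
  rw [quotientRel, add_comm, mul_comm]
  exact h

open Classical in
lemma card_le_card_quotientRel [Fintype E] [Fintype (E ⧸ H)] (x : E × (E ⧸ H)) :
    Fintype.card E ≤ #{y | quotientRel H x y} := by
  rw [← card_univ]
  refine card_le_card_of_injOn (fun a => (a, ((x.1 * a : E) : E ⧸ H) - x.2)) ?_ ?_
  · intro a _
    exact mem_coe.2 (mem_filter.2 ⟨mem_univ _, by simp [quotientRel]⟩)
  · intro a _ a' _ h
    exact (Prod.ext_iff.1 h).1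

/-- A common neighbor `(c, d)` of `(a, b)` and `(a', b')` is determined by `c`, and
`(a - a') * c` lies in a fixed coset of `H`. -/
lemma card_common_quotientRel_le [Fintype E] {x x' : E × (E ⧸ H)} (hne : x ≠ x')
    (S : Finset (E × (E ⧸ H))) (hS : ∀ y ∈ S, quotientRel H x y ∧ quotientRel H x' y) :
    #S ≤ Nat.card H := by
  classical
  have ha : x.1 ≠ x'.1 ∨ S = ∅ := by
    by_contra! h
    obtain ⟨h1, y, hy⟩ := h
    obtain ⟨h2, h3⟩ := hS y hy
    refine hne (Prod.ext h1 ?_)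
    rw [quotientRel, h1] at h2
    exact add_right_cancel (h2.trans h3.symm)
  rcases ha with ha | rfl
  · obtain ⟨c, hc⟩ := QuotientAddGroup.mk_surjective (x.2 - x'.2)
    have hH : Nat.card H = #(univ.filter fun z : E => z ∈ H) := by
      rw [Nat.card_eq_fintype_card, ← Fintype.card_subtype]
    rw [hH]
    refine card_le_card_of_injOn (fun y => (x.1 - x'.1) * y.1 - c) ?_ ?_
    · intro y hy
      obtain ⟨h1, h2⟩ := hS y hy
      refine mem_coe.2 (mem_filter.2 ⟨mem_univ _, ?_⟩)
      change (x.1 - x'.1) * y.1 - c ∈ H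
      rw [← QuotientAddGroup.eq_zero_iff, sub_mul, QuotientAddGroup.mk_sub,
        QuotientAddGroup.mk_sub, hc, ← h1, ← h2]
      abel
    · intro y hy y' hy' h
      have h1 : y.1 = y'.1 := mul_left_cancel₀ (sub_ne_zero.2 ha) (sub_left_injective h)
      refine Prod.ext h1 ?_
      have h2 := (hS y hy).1
      have h3 := (hS y' hy').1
      rw [quotientRel, h1] at h2
      exact add_left_cancel (h2.trans h3.symm)
  · simp

/-- At most two vertices of the larger part of `K_{2,t}` share an image with a vertex of the
smaller part; the others are sent to common neighbors of two distinct vertices. -/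
lemma blackCRG_quotientRel_mem_crgs [Fintype E] [Fintype (E ⧸ H)] {t : ℕ} (ht : Nat.card H + 2 < t) :
    blackCRG (quotientRel H) (quotientRel_symm H) ∈ crgs {completeBipartite 2 t} := by
  classical
  refine blackCRG_mem_crgs fun a b ha hb h => ?_
  have h01 : a 0 ≠ a 1 := fun h => absurd (ha h) (by decide)
  have hle := card_common_quotientRel_le H h01 ((univ.image b) \ {a 0, a 1}) <| by
    intro y hy
    obtain ⟨hy, h01⟩ := mem_sdiff.1 hy
    obtain ⟨j, -, rfl⟩ := mem_image.1 hy
    obtain ⟨h0, h1⟩ : b j ≠ a 0 ∧ b j ≠ a 1 := by simpa using h01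
    exact ⟨(h 0 j).resolve_left (Ne.symm h0), (h 1 j).resolve_left (Ne.symm h1)⟩
  have h1 := le_card_sdiff {a 0, a 1} (univ.image b)
  rw [card_image_of_injective _ hb, card_univ, Fintype.card_fin] at h1
  have h2 : #{a 0, a 1} ≤ 2 := card_le_two
  omega

end QuotientRelation

/-! ### The projective norm relation -/

section NormRelation

/-- Two distinct "circles" `N (Y + e) = c`, where `N z = z * σ z`, meet in at most two points. -/
lemma not_three_common_points {E : Type} [Field E] (σ : E →+* E) {e₁ e₂ c₁ c₂ : E}
    (he : e₁ ≠ e₂) {Y : Fin 3 → E} (hY : Function.Injective Y)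
    (h₁ : ∀ j, (Y j + e₁) * σ (Y j + e₁) = c₁) (h₂ : ∀ j, (Y j + e₂) * σ (Y j + e₂) = c₂) :
    False := by
  simp only [map_add] at h₁ h₂
  -- the difference of the equations expresses `σ (Y j)` linearly in `Y j`
  have hquad : ∀ j, (σ e₁ - σ e₂) * Y j ^ 2 =
      (c₁ - c₂ - e₁ * σ e₁ + e₂ * σ e₂ + (e₁ - e₂) * σ e₁ - e₁ * (σ e₁ - σ e₂)) * Y j +
      (e₁ * (c₁ - c₂ - e₁ * σ e₁ + e₂ * σ e₂ + (e₁ - e₂) * σ e₁) - (e₁ - e₂) * c₁) := by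
    intro j
    linear_combination (-(e₁ - e₂) + Y j + e₁) * h₁ j - (Y j + e₁) * h₂ j
  generalize c₁ - c₂ - e₁ * σ e₁ + e₂ * σ e₂ + (e₁ - e₂) * σ e₁ - e₁ * (σ e₁ - σ e₂) = B at hquad
  generalize e₁ * (c₁ - c₂ - e₁ * σ e₁ + e₂ * σ e₂ + (e₁ - e₂) * σ e₁) - (e₁ - e₂) * c₁ = C
    at hquad
  have hη : σ e₁ - σ e₂ ≠ 0 := sub_ne_zero.2 (σ.injective.ne he)
  have h01 : Y 0 - Y 1 ≠ 0 := sub_ne_zero.2 (hY.ne (by decide))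
  have h02 : Y 0 - Y 2 ≠ 0 := sub_ne_zero.2 (hY.ne (by decide))
  have h12 : Y 1 - Y 2 ≠ 0 := sub_ne_zero.2 (hY.ne (by decide))
  have k1 : (σ e₁ - σ e₂) * (Y 0 + Y 1) = B :=
    mul_left_cancel₀ h01 (by linear_combination hquad 0 - hquad 1)
  have k2 : (σ e₁ - σ e₂) * (Y 0 + Y 2) = B :=
    mul_left_cancel₀ h02 (by linear_combination hquad 0 - hquad 2)
  exact mul_ne_zero hη h12 (by linear_combination k1 - k2)

/-- The relation `N (A + B) = a * b`, where `N z = z * σ z`, contains no `K_{3,3}`: after division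
by the equation of a third vertex, an inversion turns the equations of two vertices of one part
into those of two distinct circles. -/
lemma not_three_three {E : Type} [Field E] (σ : E →+* E) {A B : Fin 3 → E} {a b : Fin 3 → E}
    (ha : ∀ i, a i ≠ 0) (hb : ∀ j, b j ≠ 0)
    (hA : Function.Injective fun i => (A i, a i)) (hB : Function.Injective fun j => (B j, b j))
    (h : ∀ i j, (A i + B j) * σ (A i + B j) = a i * b j) : False := by
  have hA' : Function.Injective A := fun i i' hi => hA <| Prod.ext hi <| by
    have h1 := h i 0
    rw [hi, h i' 0] at h1
    exact (mul_right_cancel₀ (hb 0) h1).symm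
  have hB' : Function.Injective B := fun j j' hj => hB <| Prod.ext hj <| by
    have h1 := h 0 j
    rw [hj, h 0 j'] at h1
    exact (mul_left_cancel₀ (ha 0) h1).symm
  have hne : ∀ i j, A i + B j ≠ 0 := fun i j h0 => by
    have := h i j
    rw [h0, zero_mul] at this
    exact mul_ne_zero (ha i) (hb j) this.symm
  have hsub : ∀ i, i ≠ 2 → A i - A 2 ≠ 0 := fun i hi => sub_ne_zero.2 (hA'.ne hi)
  have hcirc : ∀ i, i ≠ 2 → ∀ j, ((A 2 + B j)⁻¹ + (A i - A 2)⁻¹) *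
      σ ((A 2 + B j)⁻¹ + (A i - A 2)⁻¹) =
      a i / a 2 * ((A i - A 2)⁻¹ * σ (A i - A 2)⁻¹) := by
    intro i hi j
    have h1 : (A 2 + B j)⁻¹ + (A i - A 2)⁻¹ = (A i + B j) * ((A 2 + B j)⁻¹ * (A i - A 2)⁻¹) := by
      have := hne 2 j
      have := hsub i hi
      field_simp
      ring
    calc _ = (A i + B j) * σ (A i + B j) * ((A 2 + B j) * σ (A 2 + B j))⁻¹ *
          ((A i - A 2)⁻¹ * σ (A i - A 2)⁻¹) := by
          rw [h1]
          simp only [map_mul, map_inv₀, mul_inv]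
          ring
      _ = _ := by
          rw [h i j, h 2 j]
          have := ha 2
          have := hb j
          congr 1
          field_simp
  refine not_three_common_points σ (Y := fun j => (A 2 + B j)⁻¹) ?_ ?_
    (hcirc 0 (by decide)) (hcirc 1 (by decide))
  · intro h0
    exact absurd (hA' (sub_left_injective (inv_injective h0))) (by decide)
  · intro j j' hj
    exact hB' (add_left_cancel (inv_injective hj))

variable (q : ℕ) [Fact q.Prime] (E : Type) [Field E] [Algebra (ZMod q) E]

/-- The projective norm relation between two copies of `E × (ZMod q)ˣ`. -/
def normRel (x y : Bool × E × (ZMod q)ˣ) : Prop :=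
  x.1 ≠ y.1 ∧ Algebra.norm (ZMod q) (x.2.1 + y.2.1) = (x.2.2 * y.2.2 : ZMod q)

variable {q E}

lemma normRel_symm (x y : Bool × E × (ZMod q)ˣ) (h : normRel q E x y) : normRel q E y x :=
  ⟨h.1.symm, by rw [add_comm, mul_comm]; exact h.2⟩

lemma normRel_triangle_free {x y z : Bool × E × (ZMod q)ˣ} (hxy : normRel q E x y)
    (hyz : normRel q E y z) (hxz : normRel q E x z) : False := by
  have h1 := hxy.1
  have h2 := hyz.1
  have h3 := hxz.1
  revert h1 h2 h3
  generalize x.1 = a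
  generalize y.1 = b
  generalize z.1 = c
  revert a b c
  decide

variable [Fintype E]

open Classical in
lemma card_sub_one_le_card_normRel (x : Bool × E × (ZMod q)ˣ) :
    Fintype.card E - 1 ≤ #{y | normRel q E x y} := by
  rw [← Fintype.card_units, ← card_univ]
  refine card_le_card_of_injOn (fun z : Eˣ => (!x.1, (z : E) - x.2.1,
    Units.map (Algebra.norm (ZMod q) (S := E)) z / x.2.2)) ?_ ?_
  · intro z _
    exact mem_coe.2 (mem_filter.2 ⟨mem_univ _, by simp [normRel, mul_div_cancel₀]⟩)
  · intro z _ z' _ h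
    have := (Prod.ext_iff.1 (Prod.ext_iff.1 h).2).1
    exact Units.ext (sub_left_injective this)

lemma algebraMap_norm_eq_mul_frobenius (hE : Fintype.card E = q ^ 2) [CharP E q] (z : E) :
    algebraMap (ZMod q) E (Algebra.norm (ZMod q) z) = z * frobenius E q z := by
  have hq : 2 ≤ q := (Fact.out : q.Prime).two_le
  rw [FiniteField.algebraMap_norm_eq_pow, Nat.card_zmod, Nat.card_eq_fintype_card, hE,
    frobenius_def, ← pow_succ']
  congr 1
  refine Nat.div_eq_of_eq_mul_left (by omega) ?_
  rw [← one_pow 2, Nat.sq_sub_sq, one_pow]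

lemma not_normRel_three_three (hE : Fintype.card E = q ^ 2)
    {a b : Fin 3 → Bool × E × (ZMod q)ˣ} (ha : Function.Injective a)
    (hb : Function.Injective b) (h : ∀ i j, normRel q E (a i) (b j)) : False := by
  have : CharP E q := charP_of_injective_algebraMap (algebraMap (ZMod q) E).injective q
  have hinj := (algebraMap (ZMod q) E).injective
  have hbool : ∀ {s t u : Bool}, s ≠ u → t ≠ u → s = t := by decide
  refine not_three_three (frobenius E q) (A := fun i => (a i).2.1) (B := fun j => (b j).2.1)
    (a := fun i => algebraMap (ZMod q) E (a i).2.2)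
    (b := fun j => algebraMap (ZMod q) E (b j).2.2) ?_ ?_ ?_ ?_ ?_
  · intro i
    simp
  · intro j
    simp
  · intro i i' hi
    obtain ⟨h1, h2⟩ := Prod.ext_iff.1 hi
    exact ha (Prod.ext (hbool (h i 0).1 (h i' 0).1) (Prod.ext h1 (Units.ext (hinj h2))))
  · intro j j' hj
    obtain ⟨h1, h2⟩ := Prod.ext_iff.1 hj
    exact hb (Prod.ext (hbool (h 0 j).1.symm (h 0 j').1.symm)
      (Prod.ext h1 (Units.ext (hinj h2))))
  · intro i j
    rw [← algebraMap_norm_eq_mul_frobenius hE, (h i j).2, map_mul]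

/-- If a vertex of each part of `K_{3,3}` had the same image, some vertices of the two parts would
be sent to a triangle of gray edges; otherwise the gray edges contain `K_{3,3}`. -/
lemma blackCRG_normRel_mem_crgs (hE : Fintype.card E = q ^ 2) :
    blackCRG (normRel q E) normRel_symm ∈ crgs {completeBipartite 3 3} := by
  refine blackCRG_mem_crgs fun a b ha hb h => ?_
  refine not_normRel_three_three hE ha hb fun i j => (h i j).resolve_left fun hij => ?_
  obtain ⟨i', hi'⟩ : ∃ i' : Fin 3, i' ≠ i := exists_ne i
  obtain ⟨j', hj', hne⟩ : ∃ j' : Fin 3, j' ≠ j ∧ a i' ≠ b j' := by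
    obtain ⟨k, l, hk, hl, hkl⟩ : ∃ k l : Fin 3, k ≠ j ∧ l ≠ j ∧ k ≠ l :=
      (by decide : ∀ j : Fin 3, ∃ k l : Fin 3, k ≠ j ∧ l ≠ j ∧ k ≠ l) j
    by_cases hik : a i' = b k
    · exact ⟨l, hl, fun hil => hkl (hb (hik.symm.trans hil))⟩
    · exact ⟨k, hk, hik⟩
  have h1 : normRel q E (a i) (b j') := (h i j').resolve_left fun h => hj' (hb (h.symm.trans hij))
  have h2 : normRel q E (a i') (b j) := (h i' j).resolve_left fun h => hi' (ha (h.trans hij.symm))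
  have h3 : normRel q E (a i') (b j') := (h i' j').resolve_left hne
  rw [← hij] at h2
  exact normRel_triangle_free h2 h1 h3

end NormRelation

/-! ### Zero is an accumulation point -/

lemma isNontrivial_Forb_completeBipartite {s t : ℕ} (hs : 0 < s) (ht : 0 < t) :
    IsNontrivial (Forb {completeBipartite s t}) := by
  refine fun n => ⟨FinGraph.mk (Fin n) ⊥, ?_, by simp⟩
  rintro F rfl ⟨e⟩
  have h : (completeBipartite s t).graph.Adj (.inl ⟨0, hs⟩) (.inr ⟨0, ht⟩) := by
    simp [completeBipartite]
  exact e.map_rel_iff.2 h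

theorem isAccumulationPoint_three_three : IsAccumulationPoint {completeBipartite 3 3} 0 := by
  refine ⟨isNontrivial_Forb_completeBipartite (by norm_num) (by norm_num), by simp,
    not_isRegularPoint_zero fun N ε hε => ?_⟩
  obtain ⟨q, hq, hprime⟩ := Nat.exists_infinite_primes (8 * N + 2 + ⌈2 / ε⌉₊)
  have : Fact q.Prime := ⟨hprime⟩
  let E := GaloisField q 2
  let _ : Fintype E := Fintype.ofFinite E
  have hE : Fintype.card E = q ^ 2 := by
    rw [← Nat.card_eq_fintype_card]
    exact GaloisField.card q 2 two_ne_zero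
  have hqN : 8 * (N : ℝ) + 2 + 2 / ε ≤ q := by
    have h1 : ((8 * N + 2 + ⌈2 / ε⌉₊ : ℕ) : ℝ) ≤ q := by exact_mod_cast hq
    push_cast at h1
    linarith [Nat.le_ceil (2 / ε)]
  have hN : (0 : ℝ) ≤ N := Nat.cast_nonneg N
  have hε2 : 0 < 2 / ε := by positivity
  have hq2 : (2 : ℝ) < q := by linarith
  have hn : (Fintype.card (Bool × E × (ZMod q)ˣ) : ℝ) = 2 * ((q : ℝ) ^ 2 * (q - 1)) := by
    rw [Fintype.card_prod, Fintype.card_prod, hE, ZMod.card_units, Fintype.card_bool]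
    push_cast [Nat.cast_sub hprime.one_le]
    ring
  have hd : ((Fintype.card E - 1 : ℕ) : ℝ) = (q : ℝ) ^ 2 - 1 := by
    rw [hE, Nat.cast_sub (Nat.one_le_pow _ _ hprime.pos)]
    push_cast
    ring
  have hdpos : (q : ℝ) < (q : ℝ) ^ 2 - 1 := by nlinarith
  have hd0 : (0 : ℝ) < (q : ℝ) ^ 2 - 1 := by linarith
  have hn0 : (0 : ℝ) < 2 * ((q : ℝ) ^ 2 * (q - 1)) :=
    mul_pos two_pos (mul_pos (by positivity) (by linarith))
  -- twice the reciprocal of the degree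
  set p : ℝ := 2 / ((q : ℝ) ^ 2 - 1) with hp
  have hp0 : 0 ≤ p := by positivity
  have hp1 : p ≤ 1 := by
    rw [hp, div_le_one hd0]
    linarith
  have hpε : p < ε := by
    rw [hp, div_lt_comm₀ hd0 hε]
    linarith
  refine ⟨p, hp0, hp1, hpε, blackCRG (normRel q E) normRel_symm, blackCRG_normRel_mem_crgs hE, _,
    uniform_mem_stdSimplex, fun K hK hKN => ?_⟩
  refine (blackCRG_form_uniform_le card_sub_one_le_card_normRel hp0).trans_lt
    (lt_of_lt_of_le ?_ (CRG.sub_card_mul_sq_le_g hK hp0 hp1 (N := N) (by exact_mod_cast hKN)))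
  have hpd : p * ((q : ℝ) ^ 2 - 1) = 2 := div_mul_cancel₀ _ hd0.ne'
  rw [hn, hd, hpd]
  have key : N * p ^ 2 < 1 / (2 * ((q : ℝ) ^ 2 * (q - 1))) := by
    rw [hp, div_pow, ← mul_div_assoc, div_lt_div_iff₀ (by positivity) hn0]
    have h1 : 8 * (N : ℝ) + 1 < q - 1 := by linarith
    have h2 : 8 * N * (q : ℝ) ^ 2 < (q - 1) * (q + 1) ^ 2 := by nlinarith
    nlinarith [mul_lt_mul_of_pos_left h2 (show (0 : ℝ) < q - 1 by linarith)]
  have : (1 - 2) / (2 * ((q : ℝ) ^ 2 * (q - 1))) = -(1 / (2 * ((q : ℝ) ^ 2 * (q - 1)))) := by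
    ring
  rw [this]
  linarith

theorem isAccumulationPoint_two_of_nine_le {t : ℕ} (ht : 9 ≤ t) :
    IsAccumulationPoint {completeBipartite 2 t} 0 := by
  refine ⟨isNontrivial_Forb_completeBipartite (by norm_num) (by omega), by simp,
    not_isRegularPoint_zero fun N ε hε => ?_⟩
  have : Fact (Nat.Prime 5) := ⟨by norm_num⟩
  obtain ⟨k, hk⟩ := pow_unbounded_of_one_lt (2 * ((N : ℝ) + 1) + 2 / ε) (by norm_num : (1 : ℝ) < 5)
  have hN : (0 : ℝ) ≤ N := Nat.cast_nonneg N
  have hε2 : 0 < 2 / ε := by positivity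
  have hk0 : k ≠ 0 := by
    rintro rfl
    norm_num at hk
    linarith
  let E := GaloisField 5 k
  let _ : Fintype E := Fintype.ofFinite E
  have hE : Fintype.card E = 5 ^ k := by
    rw [← Nat.card_eq_fintype_card]
    exact GaloisField.card 5 k hk0
  let H : AddSubgroup E := AddSubgroup.zmultiples 1
  let _ : Fintype (E ⧸ H) := Fintype.ofFinite _
  have hH : Nat.card H = 5 := by
    rw [Nat.card_zmultiples]
    exact CharP.eq E (CharP.addOrderOf_one E) inferInstance
  set q : ℝ := 5 ^ k with hq
  have hq0 : 0 < q := by positivity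
  have hn : (Fintype.card (E × (E ⧸ H)) : ℝ) = q ^ 2 / 5 := by
    have h1 := AddSubgroup.card_eq_card_quotient_mul_card_addSubgroup H
    rw [hH, Nat.card_eq_fintype_card, Nat.card_eq_fintype_card, hE] at h1
    have h2 : q = Fintype.card (E ⧸ H) * 5 := by
      rw [hq]
      exact_mod_cast h1
    rw [Fintype.card_prod, hE]
    push_cast
    rw [← hq, eq_div_iff (by norm_num), mul_assoc, ← h2, sq]
  set p : ℝ := 2 / q with hp
  have hp0 : 0 ≤ p := by positivity
  have hpN : p * (N + 1) ≤ 1 := by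
    rw [hp, div_mul_eq_mul_div, div_le_one hq0]
    linarith
  have hp1 : p ≤ 1 := by nlinarith
  have hpε : p < ε := by
    rw [hp, div_lt_comm₀ hq0 hε]
    linarith
  refine ⟨p, hp0, hp1, hpε, blackCRG (quotientRel H) (quotientRel_symm H),
    blackCRG_quotientRel_mem_crgs H (by rw [hH]; omega), _, uniform_mem_stdSimplex, fun K hK hKN => ?_⟩
  have hKN' : p * (Fintype.card K.V + 1) ≤ 1 := by
    have : (Fintype.card K.V : ℝ) ≤ N := by exact_mod_cast hKN
    exact (mul_le_mul_of_nonneg_left (by linarith) hp0).trans hpN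
  refine (blackCRG_form_uniform_le (card_le_card_quotientRel H) hp0).trans_lt
    (lt_of_lt_of_le ?_ (CRG.mul_one_sub_le_g hK hp0 hKN'))
  have hpq : p * q = 2 := div_mul_cancel₀ _ hq0.ne'
  rw [hn, hE]
  push_cast
  rw [← hq, hpq]
  -- the gain over `p` is `5 / q ^ 2`, against `p ^ 2 = 4 / q ^ 2`
  have h1 : (1 - 2) / (q ^ 2 / 5) = -(5 / 4 * p ^ 2) := by
    rw [hp]
    field_simp
    ring
  have h2 : 0 < p ^ 2 := by positivity
  rw [h1]
  nlinarith

end EditDistance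

theorem mainTheorem6 :
    EditDistance.IsAccumulationPoint {EditDistance.completeBipartite 3 3} 0 ∧
    ∀ t : ℕ, 9 ≤ t →
      EditDistance.IsAccumulationPoint {EditDistance.completeBipartite 2 t} 0 :=
  ⟨EditDistance.isAccumulationPoint_three_three,
    fun _ ht => EditDistance.isAccumulationPoint_two_of_nine_le ht⟩
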